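/- **Model.** Let $f\ge 0$ and consider $n=3f+1$ replicas, a set of at most $f$ of which is *byzantine*; the others are *correct*, i.e. follow the FnF-BFT protocol below. Communication is asynchronous: messages may be delayed arbitrarily, reordered, duplicated or lost, and timers may expire at any moment. Clients, correct or byzantine, may broadcast any requests at any time. Byzantine replicas may sign and send anything at any time but cannot forge signatures of correct replicas. A combined threshold signature $\sigma(m)$ exists exactly if $2f+1$ distinct replicas have produced partial signatures $\sigma_w(m)$; every replica can then use it. $h$ is a hash function. **Protocol.** The protocol runs in epochs $e=1,2,\dots$; every epoch has a primary $p_e$ and a configuration, which assigns non-overlapping lists of sequence numbers and hash buckets to the replicas in their role as leaders. The $i$-th sequence number in the list of $v$ has local sequence number $i$. Loads, assignments and primaries may be chosen by any policy. *Epoch operation.* For a request $r$ submitted by an authorized client whose bucket belongs to it, leader $v$ sends $\langle\text{pre-prepare},sn,e,h(r),v\rangle$, at most one for each $(sn,e)$. A correct replica $w$ participating in epoch $e$ accepts it if $v$ leads $sn$ in $e$, $sn$ is not the number of a hanging request, the local sequence number of $sn$ exceeds that of the last stable checkpoint of $v$ in epoch $e$ by at least $1$ and at most $2k$, $r$ is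 authorized and in a bucket of $v$, and $w$ has not prepared another request with sequence number $sn$ in epoch $e$. It then signs $\sigma_w(d)$, $d=h(sn\|e\|r)$. A prepared-certificate $\langle sn,e,\sigma(d)\rangle$ of the current epoch is accepted by logging it and signing $\sigma_w(\sigma(d))$. On a commit-certificate $\langle sn,e,\sigma(\sigma(d))\rangle$ of the current epoch, the replica logs it and *commits* request $r$ with sequence number $sn$. *Checkpoints.* A replica that has committed all sequence numbers of $v$ in its current epoch with local number up to $j$, $k\mid j$, may sign a checkpoint for $v$, the epoch and $j$ with the digest of the requests since the previous checkpoint. With $2f+1$ signatures the checkpoint is stable and includes all these sequence numbers; a replica that knows it may obtain the requests matching the digest from others and commit them. *Epoch-change.* At any time a correct replica may stop participating in its epoch and call a later epoch $e$, by a signed epoch-change message with certificates of stable checkpoints known to it and, for the sequence numbers not included in these, all its logged commit-certificates ($\mathcal Q$) and its prepared-certificates for requests without logged commit-certificate ($\mathcal P$). The primary $p_e$ fixes the configuration of $e$ by a three-phase reliable broadcast (init; echo; ready after $2f+1$ echo or $f+1$ ready messages; delivery after $2f+1$ ready messages) and sends $\langle\text{new-epoch},e,\mathcal V,\mathcal O,p_e\rangle$.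 Here $\mathcal V$ consists of signed epoch-change messages for $e$ of at least $2f+1$ replicas, containing only existing certificates from epochs before $e$. For each $sn$ not included in a stable checkpoint in $\mathcal V$, $\mathcal O$ contains: a commit-certificate for $sn$ from $\mathcal V$ if there is one; otherwise, if $\mathcal V$ has a prepared-certificate for $sn$, a pre-prepare for the request of one with highest epoch; otherwise a pre-prepare for the null request or, if $sn$ is to be assigned afresh, nothing. The configuration must assign every sequence number with such a pre-prepare (hanging request), for a client request to the leader of its bucket, and none that has a commit-certificate in $\mathcal O$ or is included in a stable checkpoint in $\mathcal V$; it must name the senders of $\mathcal V$. A correct replica that has not yet entered $e$ and is not in a later epoch may, after verifying all this, enter $e$. It then logs the certificates in $\mathcal O$ and the checkpoints in $\mathcal V$, commits the requests with a commit-certificate in $\mathcal O$, and may sign $\sigma_w(h(sn\|e\|r))$ for each hanging request $r$ in $\mathcal O$ unless it has prepared another request with sequence number $sn$ in epoch $e$. **Theorem (safety).** Consider any finite execution in which no two distinct inputs hashed by correct replicas have the same hash value. If two correct replicas $u,v$ have committed requests $r$ and $r'$, respectively, with the same sequence number $sn$ (in the same or different epochs, null requests included), then $r=r'$. -/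

import Mathlib

/-!
A model of the parallel-leader byzantine fault-tolerant protocol FnF-BFT in an asynchronous
network, as a transition system.

* Network. All signed messages ever sent form a growing set, the pool. A replica may act on any
  subset of the pool, at any time and in any order: messages can be delayed, reordered, duplicated
  or lost.
* Signatures. An element `(w, m)` of the pool is the message `m` with the (partial) signature of
  `w`. Only a step of `w` adds `(w, m)` if `w` is correct; a byzantine `w` can add `(w, m)` for
  every `m` at every time. A combined `(2f+1, n)` threshold signature on `m` exists exactly if
  `2f+1` distinct replicas have signed `m` (`Quorum`), and then anyone may use it.
* Timers. A correct replica may call an epoch-change at any time and for any later epoch, so that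
  every timer policy is covered. The loads `C_v(e)`, and with them the assignment of sequence
  numbers and buckets, may likewise be chosen in any way, which covers every load policy.
* Hashing. The hash function is an arbitrary function. The state records the inputs to which
  correct replicas apply it, so that one can say that no collision occurs among them.
-/

namespace FnF

/-- The `n = 3f+1` replicas. -/
abbrev Replica (f : ℕ) := Fin (3 * f + 1)

/-- A client request: operation, timestamp, client. -/
structure Request (Op Client : Type*) where
  op : Op
  time : ℕ
  client : Client

/-- What a sequence number can be decided to hold: a client request, or the null request `none`,
whose execution is a no-op. -/
abbrev Value (Op Client : Type*) := Option (Request Op Client)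

/-- A request at a sequence number in an epoch. It also stands for the prepared-certificate or
commit-certificate `⟨sn, e, ·⟩` of that request. -/
structure Slot (Op Client : Type*) where
  sn : ℕ
  epoch : ℕ
  req : Value Op Client

/-- The inputs of the cryptographic hash function: a request `r`, a concatenation `sn ‖ e ‖ r`,
and the requests of a checkpoint interval. -/
inductive HashInput (Op Client : Type*) where
  | request (r : Value Op Client)
  | slot (t : Slot Op Client)
  | segment (l : List (ℕ × Value Op Client))

/-- The configuration of an epoch. `seqs v` lists the sequence numbers assigned to leader `v`; the
number at position `i` (from `0`) has local sequence number `i + 1`, and `C_v` is the length.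
`bucketLeader` assigns the hash buckets to leaders, `senders` names the replicas whose epoch-change
messages the primary uses, and `performance` is the reported number of requests committed in the
previous epoch. -/
structure Config (f : ℕ) where
  seqs : Replica f → List ℕ
  bucketLeader : ℕ → Replica f
  senders : Finset (Replica f)
  performance : ℕ

/-- The data of a checkpoint of `leader` in `epoch`: `sns` are the sequence numbers of this leader
in this epoch with local sequence number up to that of the checkpoint (so `sns.length` is the local
sequence number of the checkpoint), and `digest` is the hash of the requests since the previous
checkpoint. -/
structure Checkpoint (f : ℕ) (D : Type*) where
  leader : Replica f
  epoch : ℕ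
  sns : List ℕ
  digest : D

/-- The sets `C`, `P`, `Q` of an epoch-change message: checkpoint-certificates,
prepared-certificates and commit-certificates. The vector `S` can be read off from `C`. -/
structure EpochChange (f : ℕ) (Op Client D : Type*) where
  C : Set (Checkpoint f D)
  P : Set (Slot Op Client)
  Q : Set (Slot Op Client)

/-- An element of the set `O` of a new-epoch message, for a given sequence number: the
commit-certificate of a request in some earlier epoch, or a new pre-prepare for a request. -/
inductive OEntry (Op Client : Type*) where
  | commitCert (e : ℕ) (r : Value Op Client)
  | prePrepare (r : Value Op Client)

/-- The contents that replicas sign. For `d = h(sn ‖ e ‖ r)`, the partial signature `σ_w(d)` of a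
prepare message is `(w, prepare d)`, and the partial signature `σ_w(σ(d))` of a commit message is
`(w, commit d)`. -/
inductive Msg (f : ℕ) (Op Client D : Type*) where
  | prePrepare (sn e : ℕ) (d : D)
  | prepare (d : D)
  | commit (d : D)
  | checkpoint (c : Checkpoint f D)
  | epochChange (e : ℕ) (ec : EpochChange f Op Client D)
  | bcastInit (e : ℕ) (cfg : Config f)
  | bcastEcho (e : ℕ) (cfg : Config f)
  | bcastReady (e : ℕ) (cfg : Config f)
  | newEpoch (e : ℕ) (V : Replica f → Option (EpochChange f Op Client D))
      (O : ℕ → Option (OEntry Op Client))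

/-- The signed messages sent so far. -/
abbrev Pool (f : ℕ) (Op Client D : Type*) := Set (Replica f × Msg f Op Client D)

/-- The local state of a replica. `active` says that it participates in `epoch` (it does not between
calling an epoch-change and accepting a new-epoch message); `signed` are the proposals for which it
has sent a prepare signature; `cfg` and `O` are the configuration and
the set `O` with which it entered `epoch`; `prepared`, `commitCerts` and `ckpts` are the
prepared-, commit- and checkpoint-certificates it has accepted; `committed` holds the pairs
`(sn, r)` such that it has committed request `r` with sequence number `sn`. -/
structure Local (f : ℕ) (Op Client D : Type*) where
  epoch : ℕ
  active : Prop
  cfg : Config f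
  O : ℕ → Option (OEntry Op Client)
  signed : Set (Slot Op Client)
  prepared : Set (Slot Op Client)
  commitCerts : Set (Slot Op Client)
  ckpts : Set (Checkpoint f D)
  committed : Set (ℕ × Value Op Client)

/-- A global state: messages sent by replicas, requests sent by clients, local states, and the
inputs to which correct replicas have applied the hash function (a record without influence on the
execution). -/
structure State (f : ℕ) (Op Client D : Type*) where
  pool : Pool f Op Client D
  requests : Set (Request Op Client)
  loc : Replica f → Local f Op Client D
  hashed : Set (HashInput Op Client)

/-- The fixed data of an execution: checkpoint period `k`, hash function, hash bucket of each
client, authorized clients, primary of each epoch, configuration of the first epoch. -/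
structure Setup (f : ℕ) (Op Client D : Type*) where
  k : ℕ
  hash : HashInput Op Client → D
  bucketOf : Client → ℕ
  authorized : Set Client
  primary : ℕ → Replica f
  config₁ : Config f

section Protocol

variable {f : ℕ} {Op Client D : Type*}

/-- The digest `d = h(sn ‖ e ‖ r)`. -/
def Setup.digest (S : Setup f Op Client D) (t : Slot Op Client) : D := S.hash (.slot t)

/-- `m` carries a combined threshold signature: it is signed by `2f+1` distinct replicas. -/
def Quorum (pool : Pool f Op Client D) (m : Msg f Op Client D) : Prop :=
  ∃ U : Finset (Replica f), 2 * f + 1 ≤ U.card ∧ ∀ w ∈ U, (w, m) ∈ pool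

/-- `⟨prepared-certificate, sn, e, σ(d)⟩` with `d = h(sn ‖ e ‖ r)` exists. -/
def PreparedCert (S : Setup f Op Client D) (pool : Pool f Op Client D) (t : Slot Op Client) :
    Prop :=
  Quorum pool (.prepare (S.digest t))

/-- `⟨commit-certificate, sn, e, σ(σ(d))⟩` with `d = h(sn ‖ e ‖ r)` exists. -/
def CommitCert (S : Setup f Op Client D) (pool : Pool f Op Client D) (t : Slot Op Client) : Prop :=
  Quorum pool (.commit (S.digest t))

/-- A checkpoint-certificate for `c` exists. -/
def CheckpointCert (pool : Pool f Op Client D) (c : Checkpoint f D) : Prop :=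
  Quorum pool (.checkpoint c)

/-- The sequence number `sn` is included in one of the checkpoints in `C`. -/
def Covered (C : Set (Checkpoint f D)) (sn : ℕ) : Prop := ∃ c ∈ C, sn ∈ c.sns

/-- The epoch-change message `ec` is valid for epoch `e`: the certificates it contains exist and
come from earlier epochs. -/
structure ValidEpochChange (S : Setup f Op Client D) (pool : Pool f Op Client D) (e : ℕ)
    (ec : EpochChange f Op Client D) : Prop where
  ckpt : ∀ c ∈ ec.C, c.epoch < e ∧ CheckpointCert pool c
  prepared : ∀ t ∈ ec.P, t.epoch < e ∧ PreparedCert S pool t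
  committed : ∀ t ∈ ec.Q, t.epoch < e ∧ CommitCert S pool t

/-- Some checkpoint in the epoch-change messages `V` includes `sn`. -/
def StableIn (V : Replica f → Option (EpochChange f Op Client D)) (sn : ℕ) : Prop :=
  ∃ w, ∃ ec, V w = some ec ∧ Covered ec.C sn

/-- `t` is one of the prepared-certificates in the epoch-change messages `V`. -/
def PreparedIn (V : Replica f → Option (EpochChange f Op Client D)) (t : Slot Op Client) : Prop :=
  ∃ w, ∃ ec, V w = some ec ∧ t ∈ ec.P

/-- `t` is one of the commit-certificates in the epoch-change messages `V`. -/
def CommittedIn (V : Replica f → Option (EpochChange f Op Client D)) (t : Slot Op Client) : Prop :=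
  ∃ w, ∃ ec, V w = some ec ∧ t ∈ ec.Q

/-- The set `O` is computed correctly from `V`. A sequence number that no stable checkpoint in `V`
includes gets
(a) a commit-certificate from `V`, if `V` has one for it;
(b) otherwise a pre-prepare for the request with the prepared-certificate of highest epoch in `V`,
    if `V` has a prepared-certificate for it;
(c) otherwise a pre-prepare for the null request, or nothing. Nothing is meant for the sequence
    numbers beyond the last one in use, which can be assigned afresh; where these begin is left to
    the primary. -/
structure CorrectO (V : Replica f → Option (EpochChange f Op Client D))
    (O : ℕ → Option (OEntry Op Client)) : Prop where
  stable : ∀ sn, StableIn V sn → O sn = none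
  committed : ∀ sn, ¬ StableIn V sn → (∃ t, CommittedIn V t ∧ t.sn = sn) →
    ∃ t, CommittedIn V t ∧ t.sn = sn ∧ O sn = some (.commitCert t.epoch t.req)
  prepared : ∀ sn, ¬ StableIn V sn → (¬ ∃ t, CommittedIn V t ∧ t.sn = sn) →
    (∃ t, PreparedIn V t ∧ t.sn = sn) →
    ∃ t, PreparedIn V t ∧ t.sn = sn ∧ (∀ t', PreparedIn V t' → t'.sn = sn → t'.epoch ≤ t.epoch) ∧
      O sn = some (.prePrepare t.req)
  unused : ∀ sn, ¬ StableIn V sn → (¬ ∃ t, CommittedIn V t ∧ t.sn = sn) →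
    (¬ ∃ t, PreparedIn V t ∧ t.sn = sn) → O sn = some (.prePrepare none) ∨ O sn = none

/-- The configuration matches `V` and `O`: `V` holds the epoch-change messages of the announced
senders; the sequence numbers of the leaders do not overlap; every hanging request is assigned, to
the leader of its bucket (null requests: to any leader); stable and committed sequence numbers are
not assigned again. -/
structure Matches (S : Setup f Op Client D) (cfg : Config f)
    (V : Replica f → Option (EpochChange f Op Client D)) (O : ℕ → Option (OEntry Op Client)) :
    Prop where
  senders : ∀ w, w ∈ cfg.senders ↔ (V w).isSome
  nodup : ∀ v, (cfg.seqs v).Nodup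
  disjoint : ∀ v v', v ≠ v' → (cfg.seqs v).Disjoint (cfg.seqs v')
  hanging : ∀ sn r, O sn = some (.prePrepare (some r)) →
    sn ∈ cfg.seqs (cfg.bucketLeader (S.bucketOf r.client))
  hangingNull : ∀ sn, O sn = some (.prePrepare none) → ∃ v, sn ∈ cfg.seqs v
  available : ∀ v, ∀ sn ∈ cfg.seqs v, ¬ StableIn V sn ∧ ∀ e r, O sn ≠ some (.commitCert e r)

/-- The reliable broadcast of the configuration `cfg` for epoch `e` delivers `cfg`. -/
def Delivered (pool : Pool f Op Client D) (e : ℕ) (cfg : Config f) : Prop :=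
  Quorum pool (.bcastReady e cfg)

/-- The checks on the new-epoch message `⟨new-epoch, e, V, O⟩`, for the configuration `cfg` of
epoch `e`. -/
structure ValidNewEpoch (S : Setup f Op Client D) (pool : Pool f Op Client D) (e : ℕ)
    (V : Replica f → Option (EpochChange f Op Client D)) (O : ℕ → Option (OEntry Op Client))
    (cfg : Config f) : Prop where
  delivered : Delivered pool e cfg
  enough : 2 * f + 1 ≤ cfg.senders.card
  valid : ∀ w ec, V w = some ec → (w, .epochChange e ec) ∈ pool ∧ ValidEpochChange S pool e ec
  correct : CorrectO V O
  matching : Matches S cfg V O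

/-- `v` leads `sn` in the current epoch of `L`, and `sn` lies between the low and high watermarks of
`v`: its local sequence number is above that of the last stable checkpoint of `v` in this epoch, by
at most `2k`. -/
def InWindow (k : ℕ) (L : Local f Op Client D) (v : Replica f) (sn : ℕ) : Prop :=
  ∃ i, (L.cfg.seqs v)[i]? = some sn ∧
    (∀ c ∈ L.ckpts, c.leader = v → c.epoch = L.epoch → c.sns.length < i + 1) ∧
    ∃ low, (low = 0 ∨ ∃ c ∈ L.ckpts, c.leader = v ∧ c.epoch = L.epoch ∧ c.sns.length = low) ∧
      i + 1 ≤ low + 2 * k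

/-- A replica with local state `L` may handle the new client request `r` of leader `v` with sequence
number `sn`: it participates in its epoch, `sn` is within the watermarks of `v` and not reserved by
the new-epoch message, and `r` was submitted by an authorized client and is in a bucket of `v`. -/
structure Acceptable (S : Setup f Op Client D) (s : State f Op Client D)
    (L : Local f Op Client D) (v : Replica f) (sn : ℕ) (r : Request Op Client) : Prop where
  active : L.active
  window : InWindow S.k L v sn
  fresh : L.O sn = none
  submitted : r ∈ s.requests
  authorized : r.client ∈ S.authorized
  bucket : L.cfg.bucketLeader (S.bucketOf r.client) = v

/-- A replica with local state `L` has not prepared another request than that of `t` with the same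
sequence number in the same epoch. -/
def NoConflict (L : Local f Op Client D) (t : Slot Op Client) : Prop :=
  ∀ t' ∈ L.signed, t'.sn = t.sn → t'.epoch = t.epoch → t'.req = t.req

/-- The inputs that are hashed to verify the certificates in `V`. -/
def hashedIn (V : Replica f → Option (EpochChange f Op Client D)) : Set (HashInput Op Client) :=
  {x | ∃ t, (PreparedIn V t ∨ CommittedIn V t) ∧ x = .slot t}

/-- The hash function is applied to the inputs in `X`. -/
def State.applyHash (s : State f Op Client D) (X : Set (HashInput Op Client)) :
    State f Op Client D :=
  { s with hashed := s.hashed ∪ X }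

/-- Replica `w` signs and sends `m`. -/
def State.send (s : State f Op Client D) (w : Replica f) (m : Msg f Op Client D) :
    State f Op Client D :=
  { s with pool := insert (w, m) s.pool }

/-- The local state of `w` becomes `L`. -/
def State.setLoc (s : State f Op Client D) (w : Replica f) (L : Local f Op Client D) :
    State f Op Client D :=
  { s with loc := Function.update s.loc w L }

/-- The epoch-change message of a replica with local state `L` that reports the stable checkpoints
`C`: for the sequence numbers outside of these, all its commit-certificates, and its
prepared-certificates of the requests for which it has no commit-certificate. -/
def Local.epochChange (L : Local f Op Client D) (C : Set (Checkpoint f D)) :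
    EpochChange f Op Client D where
  C := C
  P := {t | t ∈ L.prepared ∧ ¬ Covered C t.sn ∧
    ¬ ∃ t' ∈ L.commitCerts, t'.sn = t.sn ∧ t'.req = t.req}
  Q := {t | t ∈ L.commitCerts ∧ ¬ Covered C t.sn}

/-- The local state after accepting `⟨new-epoch, e, V, O⟩` with configuration `cfg`: epoch `e` is
entered, the commit-certificates in `O` and the checkpoint-certificates in `V` are logged, and the
requests with a commit-certificate in `O` are committed. -/
def Local.enter (L : Local f Op Client D) (e : ℕ)
    (V : Replica f → Option (EpochChange f Op Client D)) (O : ℕ → Option (OEntry Op Client))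
    (cfg : Config f) : Local f Op Client D where
  epoch := e
  active := True
  cfg := cfg
  O := O
  signed := L.signed
  prepared := L.prepared
  commitCerts := L.commitCerts ∪ {t | O t.sn = some (.commitCert t.epoch t.req)}
  ckpts := L.ckpts ∪ {c | ∃ w, ∃ ec, V w = some ec ∧ c ∈ ec.C}
  committed := L.committed ∪ {p | ∃ e', O p.1 = some (.commitCert e' p.2)}

/-- One step of the system, with the set `byz` of byzantine replicas. -/
inductive Step (S : Setup f Op Client D) (byz : Finset (Replica f)) :
    State f Op Client D → State f Op Client D → Prop
  /-- A byzantine replica signs and sends anything. -/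
  | byzantine (s) (b : Replica f) (hb : b ∈ byz) (m : Msg f Op Client D) :
      Step S byz s (s.send b m)
  /-- A client, correct or byzantine, broadcasts a request. -/
  | request (s) (r : Request Op Client) :
      Step S byz s { s with requests := insert r s.requests }
  /-- Leader prepare phase: leader `v` proposes a request; at most one for each sequence number in
  an epoch. -/
  | propose (s) (v : Replica f) (hv : v ∉ byz) (sn : ℕ) (r : Request Op Client)
      (hacc : Acceptable S s (s.loc v) v sn r)
      (hone : ∀ d, (v, .prePrepare sn (s.loc v).epoch d) ∈ s.pool → d = S.hash (.request (some r))) :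
      Step S byz s
        ((s.applyHash {.request (some r)}).send v
          (.prePrepare sn (s.loc v).epoch (S.hash (.request (some r)))))
  /-- Backup prepare phase: `w` accepts a pre-prepare of leader `v` for its current epoch and signs
  the digest. For `w = v` this is the leader's own partial signature. -/
  | prepare (s) (w : Replica f) (hw : w ∉ byz) (v : Replica f) (sn : ℕ) (r : Request Op Client)
      (hmsg : (v, .prePrepare sn (s.loc w).epoch (S.hash (.request (some r)))) ∈ s.pool)
      (hacc : Acceptable S s (s.loc w) v sn r)
      (t : Slot Op Client) (ht : t = ⟨sn, (s.loc w).epoch, some r⟩)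
      (hno : NoConflict (s.loc w) t) :
      Step S byz s
        (((s.applyHash {.request (some r), .slot t}).setLoc w
          { s.loc w with signed := insert t (s.loc w).signed }).send w (.prepare (S.digest t)))
  /-- The same for a hanging request, whose pre-prepare is in the new-epoch message with which `w`
  entered its epoch. -/
  | prepareHanging (s) (w : Replica f) (hw : w ∉ byz) (sn : ℕ) (r : Value Op Client)
      (hact : (s.loc w).active)
      (hO : (s.loc w).O sn = some (.prePrepare r))
      (t : Slot Op Client) (ht : t = ⟨sn, (s.loc w).epoch, r⟩)
      (hno : NoConflict (s.loc w) t) :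
      Step S byz s
        (((s.applyHash {.slot t}).setLoc w
          { s.loc w with signed := insert t (s.loc w).signed }).send w (.prepare (S.digest t)))
  /-- Commit phase: `w` accepts a prepared-certificate of its current epoch and signs it. -/
  | acceptPrepared (s) (w : Replica f) (hw : w ∉ byz) (t : Slot Op Client)
      (hact : (s.loc w).active) (he : t.epoch = (s.loc w).epoch)
      (hcert : PreparedCert S s.pool t) :
      Step S byz s
        (((s.applyHash {.slot t}).setLoc w
          { s.loc w with prepared := insert t (s.loc w).prepared }).send w (.commit (S.digest t)))
  /-- `w` accepts a commit-certificate of its current epoch and commits the request. -/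
  | acceptCommit (s) (w : Replica f) (hw : w ∉ byz) (t : Slot Op Client)
      (hact : (s.loc w).active) (he : t.epoch = (s.loc w).epoch)
      (hcert : CommitCert S s.pool t) :
      Step S byz s
        ((s.applyHash {.slot t}).setLoc w { s.loc w with
          commitCerts := insert t (s.loc w).commitCerts
          committed := insert (t.sn, t.req) (s.loc w).committed })
  /-- `w` has committed all requests of leader `v` with local sequence number up to `j`, a multiple
  of `k`, and sends a checkpoint message with the digest of the requests from the previous
  checkpoint on. -/
  | sendCheckpoint (s) (w : Replica f) (hw : w ∉ byz) (v : Replica f) (j : ℕ)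
      (l : List (ℕ × Value Op Client))
      (hact : (s.loc w).active) (hj : 0 < j) (hk : S.k ∣ j)
      (hlen : j ≤ ((s.loc w).cfg.seqs v).length)
      (hall : ∀ sn ∈ ((s.loc w).cfg.seqs v).take j, ∃ r, (sn, r) ∈ (s.loc w).committed)
      (hseg : l.map Prod.fst = (((s.loc w).cfg.seqs v).take j).drop (j - S.k - 1))
      (hl : ∀ p ∈ l, p ∈ (s.loc w).committed) :
      Step S byz s
        ((s.applyHash {.segment l}).send w (.checkpoint
          ⟨v, (s.loc w).epoch, ((s.loc w).cfg.seqs v).take j, S.hash (.segment l)⟩))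
  /-- `w` sees a checkpoint-certificate: the checkpoint is stable. -/
  | acceptCheckpoint (s) (w : Replica f) (hw : w ∉ byz) (c : Checkpoint f D)
      (he : c.epoch ≤ (s.loc w).epoch) (hcert : CheckpointCert s.pool c) :
      Step S byz s (s.setLoc w { s.loc w with ckpts := insert c (s.loc w).ckpts })
  /-- `w` obtains the requests of a stable checkpoint from other replicas, checks them against the
  digest, and commits them. -/
  | commitCheckpoint (s) (w : Replica f) (hw : w ∉ byz) (c : Checkpoint f D)
      (l : List (ℕ × Value Op Client))
      (hc : c ∈ (s.loc w).ckpts) (hl : S.hash (.segment l) = c.digest) :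
      Step S byz s
        ((s.applyHash {.segment l}).setLoc w
          { s.loc w with committed := (s.loc w).committed ∪ {p | p ∈ l} })
  /-- `w` calls an epoch-change for a later epoch `e` and stops participating in its epoch. It
  reports stable checkpoints `C` known to it. -/
  | callEpochChange (s) (w : Replica f) (hw : w ∉ byz) (e : ℕ) (C : Set (Checkpoint f D))
      (he : (s.loc w).epoch < e) (hC : C ⊆ (s.loc w).ckpts) :
      Step S byz s
        ((s.setLoc w { s.loc w with epoch := e, active := False }).send w
          (.epochChange e ((s.loc w).epochChange C)))
  /-- The primary of epoch `e`, having `2f+1` valid epoch-change messages, starts the reliable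
  broadcast of the configuration of epoch `e`. -/
  | broadcastInit (s) (p : Replica f) (hp : p ∉ byz) (e : ℕ) (cfg : Config f)
      (V : Replica f → Option (EpochChange f Op Client D))
      (hprim : p = S.primary e) (hcard : 2 * f + 1 ≤ cfg.senders.card)
      (hsend : ∀ w, w ∈ cfg.senders ↔ (V w).isSome)
      (hec : ∀ w ec, V w = some ec →
        (w, .epochChange e ec) ∈ s.pool ∧ ValidEpochChange S s.pool e ec)
      (hone : ∀ cfg', (p, .bcastInit e cfg') ∈ s.pool → cfg' = cfg) :
      Step S byz s ((s.applyHash (hashedIn V)).send p (.bcastInit e cfg))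
  /-- Second phase of the reliable broadcast. -/
  | broadcastEcho (s) (w : Replica f) (hw : w ∉ byz) (e : ℕ) (cfg : Config f)
      (hinit : (S.primary e, .bcastInit e cfg) ∈ s.pool)
      (hone : ∀ cfg', (w, .bcastEcho e cfg') ∈ s.pool → cfg' = cfg) :
      Step S byz s (s.send w (.bcastEcho e cfg))
  /-- Third phase of the reliable broadcast, after `2f+1` echo or `f+1` ready messages. -/
  | broadcastReady (s) (w : Replica f) (hw : w ∉ byz) (e : ℕ) (cfg : Config f)
      (hecho : Quorum s.pool (.bcastEcho e cfg) ∨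
        ∃ U : Finset (Replica f), f + 1 ≤ U.card ∧ ∀ x ∈ U, (x, .bcastReady e cfg) ∈ s.pool)
      (hone : ∀ cfg', (w, .bcastReady e cfg') ∈ s.pool → cfg' = cfg) :
      Step S byz s (s.send w (.bcastReady e cfg))
  /-- The primary of epoch `e` sends the new-epoch message. -/
  | sendNewEpoch (s) (p : Replica f) (hp : p ∉ byz) (e : ℕ)
      (V : Replica f → Option (EpochChange f Op Client D)) (O : ℕ → Option (OEntry Op Client))
      (cfg : Config f) (hprim : p = S.primary e) (hown : (V p).isSome)
      (hvalid : ValidNewEpoch S s.pool e V O cfg) :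
      Step S byz s ((s.applyHash (hashedIn V)).send p (.newEpoch e V O))
  /-- `w` (possibly the primary itself) accepts a new-epoch message for an epoch that it has not yet
  entered, and enters it. -/
  | acceptNewEpoch (s) (w : Replica f) (hw : w ∉ byz) (e : ℕ)
      (V : Replica f → Option (EpochChange f Op Client D)) (O : ℕ → Option (OEntry Op Client))
      (cfg : Config f)
      (he : (s.loc w).epoch < e ∨ ((s.loc w).epoch = e ∧ ¬ (s.loc w).active))
      (hmsg : (S.primary e, .newEpoch e V O) ∈ s.pool)
      (hvalid : ValidNewEpoch S s.pool e V O cfg) :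
      Step S byz s ((s.applyHash (hashedIn V)).setLoc w ((s.loc w).enter e V O cfg))

/-- The initial state: nothing has been sent, all replicas are in epoch `1`. -/
def Setup.initial (S : Setup f Op Client D) : State f Op Client D where
  pool := ∅
  requests := ∅
  loc := fun _ =>
    { epoch := 1, active := True, cfg := S.config₁, O := fun _ => none, signed := ∅,
      prepared := ∅, commitCerts := ∅, ckpts := ∅, committed := ∅ }
  hashed := ∅

/-- `s` occurs in an execution in which the replicas in `byz` are byzantine and all others
correct. -/
def Reachable (S : Setup f Op Client D) (byz : Finset (Replica f)) (s : State f Op Client D) :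
    Prop :=
  Relation.ReflTransGen (Step S byz) S.initial s

/-- Up to the state `s`, the hash function has shown no collision: no two distinct inputs to which
correct replicas have applied it have the same hash. -/
def NoCollision (S : Setup f Op Client D) (s : State f Op Client D) : Prop :=
  Set.InjOn S.hash s.hashed

/-- In the state `s`, replica `u` has committed the request `r` with sequence number `sn`. -/
def Commits (s : State f Op Client D) (u : Replica f) (sn : ℕ) (r : Value Op Client) : Prop :=
  (sn, r) ∈ (s.loc u).committed

end Protocol

end FnF

/-!
Two sets of `2f+1` replicas share a correct one. Since a correct replica prepares at most one
request per sequence number and epoch, prepared-certificates of the same epoch agree.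

Across epochs, suppose that `r` has a commit-certificate for `sn` in epoch `e`, and consider a
new-epoch message for an epoch `e' > e`. One of its `2f+1` epoch-change messages comes from a
correct replica that had accepted the prepared-certificate for `r` before it left epoch `e`. Unless
`sn` is reported as stable or committed, in which case nothing is prepared for it in `e'`, some
prepared-certificate of an epoch between `e` and `e'` is reported, and the one of highest epoch
determines what can be prepared in `e'`. By induction on the epoch its request is `r`.

Checkpoints and new-epoch messages only hand over requests that have a commit-certificate. So every
committed request has one, and any two of them for the same sequence number agree.
-/

namespace FnF

variable {f : ℕ} {Op Client D : Type*} {S : Setup f Op Client D} {byz : Finset (Replica f)}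
  {s s' : State f Op Client D}

/-! ### Quorums -/

theorem exists_mem_mem_notMem_of_card_lt {α : Type*} [Fintype α] {A B C : Finset α}
    (h : Fintype.card α + C.card < A.card + B.card) : ∃ x ∈ A, x ∈ B ∧ x ∉ C := by
  classical
  have hunion : (A ∪ B).card ≤ Fintype.card α := Finset.card_le_univ _
  have hinter : C.card < (A ∩ B).card := by
    have := Finset.card_union_add_card_inter A B
    omega
  obtain ⟨x, hx, hxC⟩ := Finset.exists_mem_notMem_of_card_lt_card hinter
  exact ⟨x, Finset.mem_of_mem_inter_left hx, Finset.mem_of_mem_inter_right hx, hxC⟩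

section Quorum

variable {pool pool' : Pool f Op Client D} {m m' : Msg f Op Client D}

theorem Quorum.exists_correct_mem (h : Quorum pool m) (hbyz : byz.card ≤ f)
    {U : Finset (Replica f)} (hU : 2 * f + 1 ≤ U.card) :
    ∃ x ∈ U, x ∉ byz ∧ (x, m) ∈ pool := by
  obtain ⟨U', hU', hm⟩ := h
  obtain ⟨x, hxU, hxU', hx⟩ : ∃ x ∈ U, x ∈ U' ∧ x ∉ byz :=
    exists_mem_mem_notMem_of_card_lt (by rw [Fintype.card_fin]; omega)
  exact ⟨x, hxU, hx, hm x hxU'⟩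

theorem Quorum.exists_correct_signed_both (h : Quorum pool m) (h' : Quorum pool' m')
    (hbyz : byz.card ≤ f) : ∃ x, x ∉ byz ∧ (x, m) ∈ pool ∧ (x, m') ∈ pool' := by
  obtain ⟨U', hU', hm'⟩ := h'
  obtain ⟨x, hxU', hx, hm⟩ := h.exists_correct_mem hbyz hU'
  exact ⟨x, hx, hm, hm' x hxU'⟩

theorem Quorum.exists_correct (h : Quorum pool m) (hbyz : byz.card ≤ f) :
    ∃ x, x ∉ byz ∧ (x, m) ∈ pool :=
  let ⟨x, hx, hm, _⟩ := h.exists_correct_signed_both h hbyz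
  ⟨x, hx, hm⟩

theorem Quorum.mono (h : Quorum pool m) (hp : pool ⊆ pool') : Quorum pool' m :=
  let ⟨U, hU, hm⟩ := h
  ⟨U, hU, fun w hw => hp (hm w hw)⟩

theorem ValidEpochChange.mono {e : ℕ} {ec : EpochChange f Op Client D}
    (h : ValidEpochChange S pool e ec) (hp : pool ⊆ pool') : ValidEpochChange S pool' e ec where
  ckpt c hc := ⟨(h.ckpt c hc).1, (h.ckpt c hc).2.mono hp⟩
  prepared t ht := ⟨(h.prepared t ht).1, (h.prepared t ht).2.mono hp⟩
  committed t ht := ⟨(h.committed t ht).1, (h.committed t ht).2.mono hp⟩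

theorem ValidNewEpoch.mono {e : ℕ} {V : Replica f → Option (EpochChange f Op Client D)}
    {O : ℕ → Option (OEntry Op Client)} {cfg : Config f} (h : ValidNewEpoch S pool e V O cfg)
    (hp : pool ⊆ pool') : ValidNewEpoch S pool' e V O cfg :=
  { h with
    delivered := h.delivered.mono hp
    valid := fun w ec hw => ⟨hp (h.valid w ec hw).1, (h.valid w ec hw).2.mono hp⟩ }

end Quorum

/-! ### Verified certificates -/

/-- All messages sent and all inputs hashed in `s` are also sent and hashed in `s'`: the order in
which knowledge about certificates is monotone. Local states are not compared. -/
structure State.RecordLE (s s' : State f Op Client D) : Prop where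
  pool : s.pool ⊆ s'.pool
  hashed : s.hashed ⊆ s'.hashed

/-- A prepared-certificate that a correct replica has checked against the slot `t`. Certificates
carry only digests, so `t` itself is pinned down by recording it among the hashed inputs. -/
structure VerifiedPrepared (S : Setup f Op Client D) (s : State f Op Client D)
    (t : Slot Op Client) : Prop where
  hashed : .slot t ∈ s.hashed
  cert : PreparedCert S s.pool t

/-- A commit-certificate that a correct replica has checked against the slot `t`, in the sense of
`VerifiedPrepared`. -/
structure VerifiedCommit (S : Setup f Op Client D) (s : State f Op Client D)
    (t : Slot Op Client) : Prop where
  hashed : .slot t ∈ s.hashed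
  cert : CommitCert S s.pool t

/-- The request `r` is decided for `sn`: it has a verified commit-certificate from some epoch. -/
def Decided (S : Setup f Op Client D) (s : State f Op Client D) (sn : ℕ) (r : Value Op Client) :
    Prop :=
  ∃ e, VerifiedCommit S s ⟨sn, e, r⟩

/-- A valid new-epoch message whose certificates a correct replica has checked. -/
structure VerifiedNewEpoch (S : Setup f Op Client D) (s : State f Op Client D) (e : ℕ)
    (V : Replica f → Option (EpochChange f Op Client D)) (O : ℕ → Option (OEntry Op Client))
    (cfg : Config f) : Prop extends ValidNewEpoch S s.pool e V O cfg where
  hashed : hashedIn V ⊆ s.hashed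

/-- An epoch with set `O` and configuration `cfg` permits preparing `r` at `sn`: either `r` is
hanging there, or `sn` is assigned to a leader and left free by `O`. -/
def Permits (O : ℕ → Option (OEntry Op Client)) (cfg : Config f) (sn : ℕ) (r : Value Op Client) :
    Prop :=
  O sn = some (.prePrepare r) ∨ O sn = none ∧ ∃ v, sn ∈ cfg.seqs v

/-- The proposal `t` may be prepared: its epoch is the first one, which has no new-epoch message, or
it is permitted by a verified new-epoch message of its epoch. -/
def Permitted (S : Setup f Op Client D) (s : State f Op Client D) (t : Slot Op Client) : Prop :=
  t.epoch = 1 ∨ ∃ V O cfg, VerifiedNewEpoch S s t.epoch V O cfg ∧ Permits O cfg t.sn t.req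

section Monotonicity

variable {t : Slot Op Client}

theorem VerifiedPrepared.mono (h : VerifiedPrepared S s t) (hs : s.RecordLE s') :
    VerifiedPrepared S s' t :=
  ⟨hs.hashed h.hashed, h.cert.mono hs.pool⟩

theorem VerifiedCommit.mono (h : VerifiedCommit S s t) (hs : s.RecordLE s') :
    VerifiedCommit S s' t :=
  ⟨hs.hashed h.hashed, h.cert.mono hs.pool⟩

theorem Decided.mono {sn : ℕ} {r : Value Op Client} (h : Decided S s sn r) (hs : s.RecordLE s') :
    Decided S s' sn r :=
  h.imp fun _ hc => hc.mono hs

theorem VerifiedNewEpoch.mono {e : ℕ} {V : Replica f → Option (EpochChange f Op Client D)}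
    {O : ℕ → Option (OEntry Op Client)} {cfg : Config f} (h : VerifiedNewEpoch S s e V O cfg)
    (hs : s.RecordLE s') : VerifiedNewEpoch S s' e V O cfg :=
  ⟨h.toValidNewEpoch.mono hs.pool, h.hashed.trans hs.hashed⟩

theorem Permitted.mono (h : Permitted S s t) (hs : s.RecordLE s') : Permitted S s' t :=
  h.imp_right fun ⟨V, O, cfg, hV, hO⟩ => ⟨V, O, cfg, hV.mono hs, hO⟩

end Monotonicity

theorem NoCollision.slot_eq (hnc : NoCollision S s) {t t' : Slot Op Client}
    (ht : .slot t ∈ s.hashed) (ht' : .slot t' ∈ s.hashed) (h : S.digest t = S.digest t') :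
    t = t' :=
  HashInput.slot.inj (hnc ht ht' h)

theorem NoCollision.segment_eq (hnc : NoCollision S s) {l l' : List (ℕ × Value Op Client)}
    (hl : .segment l ∈ s.hashed) (hl' : .segment l' ∈ s.hashed)
    (h : S.hash (.segment l) = S.hash (.segment l')) : l = l' :=
  HashInput.segment.inj (hnc hl hl' h)

section NewEpoch

variable {e : ℕ} {V : Replica f → Option (EpochChange f Op Client D)}
  {O : ℕ → Option (OEntry Op Client)} {cfg : Config f} {t : Slot Op Client} {sn : ℕ}
  {r : Value Op Client}

theorem CorrectO.committedIn_of_eq_commitCert (h : CorrectO V O)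
    (hO : O sn = some (.commitCert e r)) : CommittedIn V ⟨sn, e, r⟩ := by
  have hstable : ¬ StableIn V sn := fun hst => by simp [h.stable sn hst] at hO
  have hcommitted : ∃ t, CommittedIn V t ∧ t.sn = sn := by
    by_contra hcom
    by_cases hpre : ∃ t, PreparedIn V t ∧ t.sn = sn
    · obtain ⟨t, -, -, -, ht⟩ := h.prepared sn hstable hcom hpre
      simp [ht] at hO
    · rcases h.unused sn hstable hcom hpre with ht | ht <;> simp [ht] at hO
  obtain ⟨t, ht, rfl, hOt⟩ := h.committed sn hstable hcommitted
  obtain ⟨rfl, rfl⟩ : t.epoch = e ∧ t.req = r := by simpa [hOt] using hO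
  exact ht

theorem Permits.not_stableIn (h : Permits O cfg sn r) (hO : CorrectO V O)
    (hcfg : Matches S cfg V O) : ¬ StableIn V sn := by
  rintro hst
  rcases h with hr | ⟨-, v, hv⟩
  · simp [hO.stable sn hst] at hr
  · exact (hcfg.available v sn hv).1 hst

theorem Permits.not_committedIn (h : Permits O cfg t.sn r) (hO : CorrectO V O)
    (hcfg : Matches S cfg V O) : ¬ CommittedIn V t := by
  intro ht
  obtain ⟨t', -, -, hOt'⟩ := hO.committed t.sn (h.not_stableIn hO hcfg) ⟨t, ht, rfl⟩
  simp [Permits, hOt'] at h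

theorem Permits.exists_preparedIn (h : Permits O cfg t.sn r) (hO : CorrectO V O)
    (hcfg : Matches S cfg V O) (ht : PreparedIn V t) :
    ∃ t', PreparedIn V t' ∧ t'.sn = t.sn ∧ t'.req = r ∧ t.epoch ≤ t'.epoch := by
  have hcommitted : ¬ ∃ t', CommittedIn V t' ∧ t'.sn = t.sn := by
    rintro ⟨t', ht', hsn⟩
    exact Permits.not_committedIn (hsn ▸ h) hO hcfg ht'
  obtain ⟨t', ht', hsn, hmax, hOt'⟩ :=
    hO.prepared t.sn (h.not_stableIn hO hcfg) hcommitted ⟨t, ht, rfl⟩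
  exact ⟨t', ht', hsn, by simpa [Permits, hOt'] using h, hmax t ht rfl⟩

theorem VerifiedNewEpoch.verifiedPrepared (h : VerifiedNewEpoch S s e V O cfg)
    (ht : PreparedIn V t) : t.epoch < e ∧ VerifiedPrepared S s t := by
  have hhashed : .slot t ∈ s.hashed := h.hashed ⟨t, Or.inl ht, rfl⟩
  obtain ⟨w, ec, hw, htP⟩ := ht
  obtain ⟨hlt, hcert⟩ := (h.valid w ec hw).2.prepared t htP
  exact ⟨hlt, hhashed, hcert⟩

theorem VerifiedNewEpoch.verifiedCommit (h : VerifiedNewEpoch S s e V O cfg)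
    (ht : CommittedIn V t) : VerifiedCommit S s t := by
  have hhashed : .slot t ∈ s.hashed := h.hashed ⟨t, Or.inr ht, rfl⟩
  obtain ⟨w, ec, hw, htQ⟩ := ht
  exact ⟨hhashed, ((h.valid w ec hw).2.committed t htQ).2⟩

end NewEpoch

/-! ### The invariant -/

/-- The epoch-change message `ec` accounts for the prepared slot `t`: through a stable checkpoint,
its prepared-certificate, or a commit-certificate for the same sequence number. -/
def EpochChange.Reports (ec : EpochChange f Op Client D) (t : Slot Op Client) : Prop :=
  Covered ec.C t.sn ∨ t ∈ ec.P ∨ ∃ t' ∈ ec.Q, t'.sn = t.sn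

theorem Local.epochChange_reports {L : Local f Op Client D} {t : Slot Op Client}
    (ht : t ∈ L.prepared) (C : Set (Checkpoint f D)) : (L.epochChange C).Reports t := by
  by_cases hcov : Covered C t.sn
  · exact Or.inl hcov
  by_cases hcommit : ∃ t' ∈ L.commitCerts, t'.sn = t.sn ∧ t'.req = t.req
  · obtain ⟨t', ht', hsn, -⟩ := hcommit
    exact Or.inr (Or.inr ⟨t', ⟨ht', hsn ▸ hcov⟩, hsn⟩)
  · exact Or.inr (Or.inl ⟨ht, hcov, hcommit⟩)

/-- The part of the protocol invariant that concerns the local state `L` of a correct replica in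
the global state `s`: whatever `L` has logged or committed is backed by verified certificates. -/
structure Local.Consistent (S : Setup f Op Client D) (s : State f Op Client D)
    (L : Local f Op Client D) : Prop where
  epoch_pos : 0 < L.epoch
  entered : L.active → L.epoch = 1 ∨ ∃ V, VerifiedNewEpoch S s L.epoch V L.O L.cfg
  signed_hashed : ∀ t ∈ L.signed, .slot t ∈ s.hashed
  signed_permitted : ∀ t ∈ L.signed, Permitted S s t
  signed_noConflict : ∀ t ∈ L.signed, NoConflict L t
  prepared : ∀ t ∈ L.prepared, VerifiedPrepared S s t
  prepared_epoch_pos : ∀ t ∈ L.prepared, 0 < t.epoch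
  ckpts : ∀ c ∈ L.ckpts, CheckpointCert s.pool c
  committed : ∀ sn r, (sn, r) ∈ L.committed → Decided S s sn r

/-- The part of the protocol invariant that concerns a message sent by a correct replica with local
state `L`, where `hashed` are the inputs hashed so far. An epoch-change message for `e` need only
report certificates from before `e`, and its sender never returns to an epoch before `e`: therefore
certificates that the sender accepts later do not invalidate the clause. -/
def Local.Backs (S : Setup f Op Client D) (hashed : Set (HashInput Op Client))
    (L : Local f Op Client D) : Msg f Op Client D → Prop
  | .prepare d => ∃ t ∈ L.signed, S.digest t = d
  | .commit d => ∃ t ∈ L.prepared, S.digest t = d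
  | .checkpoint c => ∃ l, .segment l ∈ hashed ∧ S.hash (.segment l) = c.digest ∧
      ∀ p ∈ l, p ∈ L.committed
  | .epochChange e ec => e ≤ L.epoch ∧ ∀ t ∈ L.prepared, t.epoch < e → ec.Reports t
  | _ => True

/-- The invariant of the protocol: the local states of correct replicas are consistent, and they
back the messages these replicas have sent. -/
structure Invariant (S : Setup f Op Client D) (byz : Finset (Replica f))
    (s : State f Op Client D) : Prop where
  consistent : ∀ w ∉ byz, (s.loc w).Consistent S s
  backs : ∀ w ∉ byz, ∀ m, (w, m) ∈ s.pool → (s.loc w).Backs S s.hashed m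

/-- The changes that a correct replica makes to its local state and that keep its past messages
backed: epochs and logs only grow, and new prepared-certificates are not from past epochs. -/
structure Local.Extends (L L' : Local f Op Client D) : Prop where
  epoch : L.epoch ≤ L'.epoch
  signed : L.signed ⊆ L'.signed
  prepared : L.prepared ⊆ L'.prepared
  prepared_new : ∀ t ∈ L'.prepared, t ∈ L.prepared ∨ L.epoch ≤ t.epoch
  committed : L.committed ⊆ L'.committed

theorem Local.Extends.refl (L : Local f Op Client D) : L.Extends L :=
  ⟨le_rfl, subset_rfl, subset_rfl, fun _ => Or.inl, subset_rfl⟩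

theorem Local.Consistent.mono {L : Local f Op Client D} (h : L.Consistent S s)
    (hs : s.RecordLE s') : L.Consistent S s' where
  epoch_pos := h.epoch_pos
  entered ha := (h.entered ha).imp_right fun ⟨V, hV⟩ => ⟨V, hV.mono hs⟩
  signed_hashed t ht := hs.hashed (h.signed_hashed t ht)
  signed_permitted t ht := (h.signed_permitted t ht).mono hs
  signed_noConflict := h.signed_noConflict
  prepared t ht := (h.prepared t ht).mono hs
  prepared_epoch_pos := h.prepared_epoch_pos
  ckpts c hc := (h.ckpts c hc).mono hs.pool
  committed sn r hr := (h.committed sn r hr).mono hs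

theorem Local.Backs.mono {hashed hashed' : Set (HashInput Op Client)} {L L' : Local f Op Client D}
    {m : Msg f Op Client D} (h : L.Backs S hashed m) (hh : hashed ⊆ hashed') (hL : L.Extends L') :
    L'.Backs S hashed' m := by
  cases m with
  | prepare d => exact h.imp fun t ht => ⟨hL.signed ht.1, ht.2⟩
  | commit d => exact h.imp fun t ht => ⟨hL.prepared ht.1, ht.2⟩
  | checkpoint c =>
    obtain ⟨l, hl, hd, hc⟩ := h
    exact ⟨l, hh hl, hd, fun p hp => hL.committed (hc p hp)⟩
  | epochChange e ec =>
    obtain ⟨he, hreports⟩ := h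
    refine ⟨he.trans hL.epoch, fun t ht hlt => ?_⟩
    rcases hL.prepared_new t ht with hold | hnew
    · exact hreports t hold hlt
    · exact absurd (he.trans hnew) hlt.not_ge
  | _ => trivial

theorem State.setLoc_loc_self (s : State f Op Client D) (w : Replica f) (L : Local f Op Client D) :
    (s.setLoc w L).loc w = L :=
  Function.update_self ..

theorem State.setLoc_loc_of_ne (s : State f Op Client D) {w x : Replica f} (h : x ≠ w)
    (L : Local f Op Client D) : (s.setLoc w L).loc x = s.loc x :=
  Function.update_of_ne h ..

theorem State.mem_hashed_applyHash {X : Set (HashInput Op Client)} {x : HashInput Op Client}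
    (hx : x ∈ X) : x ∈ (s.applyHash X).hashed :=
  Or.inr hx

theorem Invariant.initial (S : Setup f Op Client D) (byz : Finset (Replica f)) :
    Invariant S byz S.initial where
  consistent _ _ := by constructor <;> simp [Setup.initial]
  backs _ _ _ hm := hm.elim

theorem Invariant.applyHash (h : Invariant S byz s) (X : Set (HashInput Op Client)) :
    Invariant S byz (s.applyHash X) where
  consistent w hw := (h.consistent w hw).mono ⟨subset_rfl, Set.subset_union_left⟩
  backs w hw m hm := (h.backs w hw m hm).mono Set.subset_union_left (.refl _)

theorem Invariant.request (h : Invariant S byz s) (R : Set (Request Op Client)) :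
    Invariant S byz { s with requests := R } where
  consistent w hw := (h.consistent w hw).mono ⟨subset_rfl, subset_rfl⟩
  backs := h.backs

theorem Invariant.send (h : Invariant S byz s) (w : Replica f) {m : Msg f Op Client D}
    (hm : w ∉ byz → (s.loc w).Backs S s.hashed m) : Invariant S byz (s.send w m) where
  consistent x hx := (h.consistent x hx).mono ⟨Set.subset_insert _ _, subset_rfl⟩
  backs x hx m' := by
    rintro (hnew | hold)
    · obtain ⟨rfl, rfl⟩ := Prod.ext_iff.1 hnew
      exact hm hx
    · exact h.backs x hx m' hold

theorem Invariant.setLoc (h : Invariant S byz s) (w : Replica f) {L : Local f Op Client D}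
    (hext : (s.loc w).Extends L) (hL : L.Consistent S s) : Invariant S byz (s.setLoc w L) := by
  have hloc : ∀ x ∉ byz,
      (s.loc x).Extends ((s.setLoc w L).loc x) ∧ ((s.setLoc w L).loc x).Consistent S s := by
    intro x hx
    rcases eq_or_ne x w with rfl | hne
    · rw [State.setLoc_loc_self]
      exact ⟨hext, hL⟩
    · rw [State.setLoc_loc_of_ne s hne]
      exact ⟨.refl _, h.consistent x hx⟩
  exact
    { consistent := fun x hx => (hloc x hx).2.mono ⟨subset_rfl, subset_rfl⟩
      backs := fun x hx m hm => (h.backs x hx m hm).mono subset_rfl (hloc x hx).1 }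

theorem Invariant.setLoc_send (h : Invariant S byz s) (w : Replica f) {L : Local f Op Client D}
    {m : Msg f Op Client D} (hext : (s.loc w).Extends L) (hL : L.Consistent S s)
    (hm : L.Backs S s.hashed m) : Invariant S byz ((s.setLoc w L).send w m) :=
  (h.setLoc w hext hL).send w fun _ => by rwa [State.setLoc_loc_self]

/-! ### Protocol steps -/

section Steps

variable {w : Replica f} {t : Slot Op Client}

theorem Local.Consistent.sign {L : Local f Op Client D} (h : L.Consistent S s)
    (ht : .slot t ∈ s.hashed) (hperm : Permitted S s t) (hno : NoConflict L t) :
    Local.Consistent S s { L with signed := insert t L.signed } :=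
  { h with
    signed_hashed := Set.forall_mem_insert.2 ⟨ht, h.signed_hashed⟩
    signed_permitted := Set.forall_mem_insert.2 ⟨hperm, h.signed_permitted⟩
    signed_noConflict := by
      rintro t₁ (rfl | h₁) t₂ (rfl | h₂) hsn he
      · rfl
      · exact hno t₂ h₂ hsn he
      · exact (hno t₁ h₁ hsn.symm he.symm).symm
      · exact h.signed_noConflict t₁ h₁ t₂ h₂ hsn he }

theorem Local.Consistent.permitted {L : Local f Op Client D} (h : L.Consistent S s)
    (hactive : L.active) {sn : ℕ} {r : Value Op Client} (hr : Permits L.O L.cfg sn r) :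
    Permitted S s ⟨sn, L.epoch, r⟩ :=
  (h.entered hactive).imp_right fun ⟨V, hV⟩ => ⟨V, L.O, L.cfg, hV, hr⟩

theorem Acceptable.permits {L : Local f Op Client D} {v : Replica f} {sn : ℕ}
    {r : Request Op Client} (h : Acceptable S s L v sn r) : Permits L.O L.cfg sn (some r) :=
  let ⟨_, hi, _⟩ := h.window
  Or.inr ⟨h.fresh, v, List.mem_of_getElem? hi⟩

theorem Invariant.sign (h : Invariant S byz s) (hw : w ∉ byz) (ht : .slot t ∈ s.hashed)
    (hperm : Permitted S s t) (hno : NoConflict (s.loc w) t) :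
    Invariant S byz ((s.setLoc w { s.loc w with signed := insert t (s.loc w).signed }).send w
      (.prepare (S.digest t))) :=
  h.setLoc_send w { Local.Extends.refl (s.loc w) with signed := Set.subset_insert _ _ }
    ((h.consistent w hw).sign ht hperm hno) ⟨t, Set.mem_insert _ _, rfl⟩

theorem Invariant.acceptPrepared (h : Invariant S byz s) (hw : w ∉ byz)
    (ht : VerifiedPrepared S s t) (he : t.epoch = (s.loc w).epoch) :
    Invariant S byz ((s.setLoc w { s.loc w with prepared := insert t (s.loc w).prepared }).send w
      (.commit (S.digest t))) := by
  have hL := h.consistent w hw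
  exact h.setLoc_send w (L := { s.loc w with prepared := insert t (s.loc w).prepared })
    { Local.Extends.refl (s.loc w) with
      prepared := Set.subset_insert _ _
      prepared_new := Set.forall_mem_insert.2 ⟨Or.inr he.ge, fun _ => Or.inl⟩ }
    { hL with
      prepared := Set.forall_mem_insert.2 ⟨ht, hL.prepared⟩
      prepared_epoch_pos := Set.forall_mem_insert.2 ⟨he ▸ hL.epoch_pos, hL.prepared_epoch_pos⟩ }
    ⟨t, Set.mem_insert _ _, rfl⟩

theorem Invariant.commit (h : Invariant S byz s) (hw : w ∉ byz) {Q : Set (Slot Op Client)}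
    {K : Set (ℕ × Value Op Client)} (hsub : (s.loc w).committed ⊆ K)
    (hK : ∀ sn r, (sn, r) ∈ K → Decided S s sn r) :
    Invariant S byz (s.setLoc w { s.loc w with commitCerts := Q, committed := K }) :=
  h.setLoc w { Local.Extends.refl (s.loc w) with committed := hsub }
    { h.consistent w hw with committed := hK }

theorem Invariant.acceptCommit (h : Invariant S byz s) (hw : w ∉ byz)
    (ht : VerifiedCommit S s t) :
    Invariant S byz (s.setLoc w { s.loc w with
      commitCerts := insert t (s.loc w).commitCerts
      committed := insert (t.sn, t.req) (s.loc w).committed }) := by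
  refine h.commit hw (Set.subset_insert _ _) fun sn r hr => ?_
  rcases hr with hnew | hold
  · obtain ⟨rfl, rfl⟩ := Prod.ext_iff.1 hnew
    exact ⟨t.epoch, ht⟩
  · exact (h.consistent w hw).committed sn r hold

theorem Invariant.acceptCheckpoint (h : Invariant S byz s) (hw : w ∉ byz) {c : Checkpoint f D}
    (hc : CheckpointCert s.pool c) :
    Invariant S byz (s.setLoc w { s.loc w with ckpts := insert c (s.loc w).ckpts }) :=
  h.setLoc w { Local.Extends.refl (s.loc w) with }
    { h.consistent w hw with
      ckpts := Set.forall_mem_insert.2 ⟨hc, (h.consistent w hw).ckpts⟩ }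

theorem Invariant.decided_of_checkpointCert (h : Invariant S byz s) (hbyz : byz.card ≤ f)
    (hnc : NoCollision S s) {c : Checkpoint f D} (hc : CheckpointCert s.pool c)
    {l : List (ℕ × Value Op Client)} (hl : .segment l ∈ s.hashed)
    (hd : S.hash (.segment l) = c.digest) {sn : ℕ} {r : Value Op Client} (hr : (sn, r) ∈ l) :
    Decided S s sn r := by
  obtain ⟨x, hx, hm⟩ := hc.exists_correct hbyz
  obtain ⟨l', hl', hd', hcommitted⟩ := h.backs x hx _ hm
  obtain rfl : l = l' := hnc.segment_eq hl hl' (hd.trans hd'.symm)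
  exact (h.consistent x hx).committed sn r (hcommitted _ hr)

theorem Invariant.commitCheckpoint (h : Invariant S byz s) (hbyz : byz.card ≤ f)
    (hnc : NoCollision S s) (hw : w ∉ byz) {c : Checkpoint f D} (hc : c ∈ (s.loc w).ckpts)
    {l : List (ℕ × Value Op Client)} (hl : .segment l ∈ s.hashed)
    (hd : S.hash (.segment l) = c.digest) :
    Invariant S byz
      (s.setLoc w { s.loc w with committed := (s.loc w).committed ∪ {p | p ∈ l} }) := by
  have hL := h.consistent w hw
  refine h.commit hw Set.subset_union_left fun sn r hr => ?_
  rcases hr with hold | hnew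
  · exact hL.committed sn r hold
  · exact h.decided_of_checkpointCert hbyz hnc (hL.ckpts c hc) hl hd hnew

theorem Invariant.callEpochChange (h : Invariant S byz s) (hw : w ∉ byz) {e : ℕ}
    (he : (s.loc w).epoch ≤ e) (C : Set (Checkpoint f D)) :
    Invariant S byz ((s.setLoc w { s.loc w with epoch := e, active := False }).send w
      (.epochChange e ((s.loc w).epochChange C))) :=
  h.setLoc_send w { Local.Extends.refl (s.loc w) with epoch := he }
    { h.consistent w hw with
      epoch_pos := (h.consistent w hw).epoch_pos.trans_le he
      entered := False.elim }
    ⟨le_rfl, fun _ ht _ => Local.epochChange_reports ht C⟩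

theorem Invariant.enter (h : Invariant S byz s) (hw : w ∉ byz) {e : ℕ}
    {V : Replica f → Option (EpochChange f Op Client D)} {O : ℕ → Option (OEntry Op Client)}
    {cfg : Config f} (he : (s.loc w).epoch ≤ e) (hV : VerifiedNewEpoch S s e V O cfg) :
    Invariant S byz (s.setLoc w ((s.loc w).enter e V O cfg)) := by
  have hL := h.consistent w hw
  have hckpts : ∀ c ∈ ((s.loc w).enter e V O cfg).ckpts, CheckpointCert s.pool c := by
    rintro c (hold | ⟨x, ec, hx, hc⟩)
    · exact hL.ckpts c hold
    · exact ((hV.valid x ec hx).2.ckpt c hc).2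
  have hcommitted : ∀ sn r, (sn, r) ∈ ((s.loc w).enter e V O cfg).committed →
      Decided S s sn r := by
    rintro sn r (hold | ⟨e', hO⟩)
    · exact hL.committed sn r hold
    · exact ⟨e', hV.verifiedCommit (hV.correct.committedIn_of_eq_commitCert hO)⟩
  exact h.setLoc w
    { Local.Extends.refl (s.loc w) with epoch := he, committed := Set.subset_union_left }
    { hL with
      epoch_pos := hL.epoch_pos.trans_le he
      entered := fun _ => Or.inr ⟨V, hV⟩
      ckpts := hckpts
      committed := hcommitted }

end Steps

theorem Invariant.step (h : Invariant S byz s) (hbyz : byz.card ≤ f) (hst : Step S byz s s')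
    (hnc : NoCollision S s') : Invariant S byz s' := by
  cases hst with
  | byzantine b hb m => exact h.send b fun hb' => absurd hb hb'
  | request r => exact h.request _
  | propose v hv sn r hacc hone => exact (h.applyHash _).send v fun _ => trivial
  | prepare w hw v sn r hmsg hacc t ht hno =>
    subst ht
    have h' := h.applyHash {.request (some r), .slot ⟨sn, (s.loc w).epoch, some r⟩}
    exact h'.sign hw (State.mem_hashed_applyHash (Or.inr rfl))
      ((h'.consistent w hw).permitted hacc.active hacc.permits) hno
  | prepareHanging w hw sn r hact hO t ht hno =>
    subst ht
    have h' := h.applyHash {.slot ⟨sn, (s.loc w).epoch, r⟩}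
    exact h'.sign hw (State.mem_hashed_applyHash rfl)
      ((h'.consistent w hw).permitted hact (Or.inl hO)) hno
  | acceptPrepared w hw t hact he hcert =>
    exact (h.applyHash _).acceptPrepared hw ⟨State.mem_hashed_applyHash rfl, hcert⟩ he
  | acceptCommit w hw t hact he hcert =>
    exact (h.applyHash _).acceptCommit hw ⟨State.mem_hashed_applyHash rfl, hcert⟩
  | sendCheckpoint w hw v j l hact hj hk hlen hall hseg hl =>
    exact (h.applyHash _).send w fun _ => ⟨l, State.mem_hashed_applyHash rfl, rfl, hl⟩
  | acceptCheckpoint w hw c he hcert => exact h.acceptCheckpoint hw hcert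
  | commitCheckpoint w hw c l hc hl =>
    exact (h.applyHash _).commitCheckpoint hbyz hnc hw hc (State.mem_hashed_applyHash rfl) hl
  | callEpochChange w hw e C he hC => exact h.callEpochChange hw he.le C
  | broadcastInit p hp e cfg V hprim hcard hsend hec hone =>
    exact (h.applyHash _).send p fun _ => trivial
  | broadcastEcho w hw e cfg hinit hone => exact h.send w fun _ => trivial
  | broadcastReady w hw e cfg hecho hone => exact h.send w fun _ => trivial
  | sendNewEpoch p hp e V O cfg hprim hown hvalid =>
    exact (h.applyHash _).send p fun _ => trivial
  | acceptNewEpoch w hw e V O cfg he hmsg hvalid =>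
    exact (h.applyHash (hashedIn V)).enter hw (he.elim le_of_lt fun he => he.1.le)
      ⟨hvalid, Set.subset_union_right⟩

theorem Step.hashed_subset (h : Step S byz s s') : s.hashed ⊆ s'.hashed := by
  cases h <;> first | exact subset_rfl | exact Set.subset_union_left

theorem Reachable.invariant (hs : Reachable S byz s) (hbyz : byz.card ≤ f)
    (hnc : NoCollision S s) : Invariant S byz s := by
  induction hs with
  | refl => exact .initial S byz
  | tail _ hst ih => exact (ih (hnc.mono hst.hashed_subset)).step hbyz hst hnc

/-! ### Agreement -/

section Agreement

variable {t t' : Slot Op Client}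

theorem Invariant.mem_signed (h : Invariant S byz s) (hnc : NoCollision S s) {x : Replica f}
    (hx : x ∉ byz) (ht : .slot t ∈ s.hashed) (hm : (x, .prepare (S.digest t)) ∈ s.pool) :
    t ∈ (s.loc x).signed := by
  obtain ⟨t', ht', hd⟩ := h.backs x hx _ hm
  exact hnc.slot_eq ((h.consistent x hx).signed_hashed t' ht') ht hd ▸ ht'

theorem Invariant.mem_prepared (h : Invariant S byz s) (hnc : NoCollision S s) {x : Replica f}
    (hx : x ∉ byz) (ht : .slot t ∈ s.hashed) (hm : (x, .commit (S.digest t)) ∈ s.pool) :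
    t ∈ (s.loc x).prepared := by
  obtain ⟨t', ht', hd⟩ := h.backs x hx _ hm
  exact hnc.slot_eq ((h.consistent x hx).prepared t' ht').hashed ht hd ▸ ht'

theorem Invariant.req_eq_of_verifiedPrepared (h : Invariant S byz s) (hbyz : byz.card ≤ f)
    (hnc : NoCollision S s) (ht : VerifiedPrepared S s t) (ht' : VerifiedPrepared S s t')
    (hsn : t.sn = t'.sn) (he : t.epoch = t'.epoch) : t.req = t'.req := by
  obtain ⟨x, hx, hm, hm'⟩ := ht.cert.exists_correct_signed_both ht'.cert hbyz
  exact (h.consistent x hx).signed_noConflict t' (h.mem_signed hnc hx ht'.hashed hm') t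
    (h.mem_signed hnc hx ht.hashed hm) hsn he

theorem Invariant.permitted_of_verifiedPrepared (h : Invariant S byz s) (hbyz : byz.card ≤ f)
    (hnc : NoCollision S s) (ht : VerifiedPrepared S s t) : Permitted S s t := by
  obtain ⟨x, hx, hm⟩ := ht.cert.exists_correct hbyz
  exact (h.consistent x hx).signed_permitted t (h.mem_signed hnc hx ht.hashed hm)

theorem Invariant.verifiedPrepared_of_verifiedCommit (h : Invariant S byz s)
    (hbyz : byz.card ≤ f) (hnc : NoCollision S s) (ht : VerifiedCommit S s t) :
    0 < t.epoch ∧ VerifiedPrepared S s t := by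
  obtain ⟨x, hx, hm⟩ := ht.cert.exists_correct hbyz
  have hmem := h.mem_prepared hnc hx ht.hashed hm
  exact ⟨(h.consistent x hx).prepared_epoch_pos t hmem, (h.consistent x hx).prepared t hmem⟩

theorem Invariant.exists_reports_of_verifiedCommit (h : Invariant S byz s) (hbyz : byz.card ≤ f)
    (hnc : NoCollision S s) (ht : VerifiedCommit S s t) {e : ℕ} (he : t.epoch < e)
    {V : Replica f → Option (EpochChange f Op Client D)} {O : ℕ → Option (OEntry Op Client)}
    {cfg : Config f} (hV : ValidNewEpoch S s.pool e V O cfg) :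
    ∃ w ec, V w = some ec ∧ ec.Reports t := by
  obtain ⟨w, hw, hwbyz, hm⟩ := ht.cert.exists_correct_mem hbyz hV.enough
  obtain ⟨ec, hec⟩ := Option.isSome_iff_exists.1 ((hV.matching.senders w).1 hw)
  obtain ⟨-, hreports⟩ := h.backs w hwbyz _ (hV.valid w ec hec).1
  exact ⟨w, ec, hec, hreports t (h.mem_prepared hnc hwbyz ht.hashed hm) he⟩

theorem Invariant.exists_earlier_verifiedPrepared (h : Invariant S byz s) (hbyz : byz.card ≤ f)
    (hnc : NoCollision S s) (ht : VerifiedCommit S s t) (ht' : VerifiedPrepared S s t')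
    (hsn : t'.sn = t.sn) (hlt : t.epoch < t'.epoch) :
    ∃ t₁, VerifiedPrepared S s t₁ ∧ t₁.sn = t.sn ∧ t₁.req = t'.req ∧ t.epoch ≤ t₁.epoch ∧
      t₁.epoch < t'.epoch := by
  have hpos : 0 < t.epoch := (h.verifiedPrepared_of_verifiedCommit hbyz hnc ht).1
  obtain ⟨V, O, cfg, hV, hperm⟩ :=
    (h.permitted_of_verifiedPrepared hbyz hnc ht').resolve_left (by omega)
  rw [hsn] at hperm
  have hprepared : PreparedIn V t := by
    obtain ⟨w, ec, hec, hstable | hprep | ⟨t₂, ht₂, hsn₂⟩⟩ :=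
      h.exists_reports_of_verifiedCommit hbyz hnc ht hlt hV.toValidNewEpoch
    · exact absurd ⟨w, ec, hec, hstable⟩ (hperm.not_stableIn hV.correct hV.matching)
    · exact ⟨w, ec, hec, hprep⟩
    · rw [← hsn₂] at hperm
      exact absurd ⟨w, ec, hec, ht₂⟩ (hperm.not_committedIn hV.correct hV.matching)
  obtain ⟨t₁, ht₁, hsn₁, hreq, hle⟩ := hperm.exists_preparedIn hV.correct hV.matching hprepared
  obtain ⟨hlt₁, hverified⟩ := hV.verifiedPrepared ht₁
  exact ⟨t₁, hverified, hsn₁, hreq, hle, hlt₁⟩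

theorem Invariant.req_eq_of_verifiedCommit_of_le (h : Invariant S byz s) (hbyz : byz.card ≤ f)
    (hnc : NoCollision S s) (ht : VerifiedCommit S s t) (ht' : VerifiedPrepared S s t')
    (hsn : t'.sn = t.sn) (hle : t.epoch ≤ t'.epoch) : t'.req = t.req := by
  induction hn : t'.epoch using Nat.strong_induction_on generalizing t' with
  | _ n ih =>
    subst hn
    rcases hle.eq_or_lt with he | hlt
    · exact h.req_eq_of_verifiedPrepared hbyz hnc ht'
        (h.verifiedPrepared_of_verifiedCommit hbyz hnc ht).2 hsn he.symm
    · obtain ⟨t₁, ht₁, hsn₁, hreq, hle₁, hlt₁⟩ :=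
        h.exists_earlier_verifiedPrepared hbyz hnc ht ht' hsn hlt
      exact hreq ▸ ih t₁.epoch hlt₁ ht₁ hsn₁ hle₁ rfl

theorem Invariant.decided_unique (h : Invariant S byz s) (hbyz : byz.card ≤ f)
    (hnc : NoCollision S s) {sn : ℕ} {r r' : Value Op Client} (hr : Decided S s sn r)
    (hr' : Decided S s sn r') : r = r' := by
  obtain ⟨e, hc⟩ := hr
  obtain ⟨e', hc'⟩ := hr'
  rcases le_total e e' with hle | hle
  · exact (h.req_eq_of_verifiedCommit_of_le hbyz hnc hc
      (h.verifiedPrepared_of_verifiedCommit hbyz hnc hc').2 rfl hle).symm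
  · exact h.req_eq_of_verifiedCommit_of_le hbyz hnc hc'
      (h.verifiedPrepared_of_verifiedCommit hbyz hnc hc).2 rfl hle

end Agreement

end FnF

theorem mainTheorem1 {f : ℕ} {Op Client D : Type*} (S : FnF.Setup f Op Client D)
    (byz : Finset (FnF.Replica f)) (at_most_f_byzantine : byz.card ≤ f)
    (s : FnF.State f Op Client D) (hs : FnF.Reachable S byz s)
    (no_collision : FnF.NoCollision S s)
    (u v : FnF.Replica f) (hu : u ∉ byz) (hv : v ∉ byz)
    (sn : ℕ) (r r' : FnF.Value Op Client)
    (hur : FnF.Commits s u sn r) (hvr : FnF.Commits s v sn r') :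
    r = r' := by
  have inv : FnF.Invariant S byz s := hs.invariant at_most_f_byzantine no_collision
  have hr : FnF.Decided S s sn r := (inv.consistent u hu).committed sn r hur
  have hr' : FnF.Decided S s sn r' := (inv.consistent v hv).committed sn r' hvr
  exact inv.decided_unique at_most_f_byzantine no_collision hr hr'
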